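/- Let $G=(V,E)$ be a finite undirected graph with $n=|V|$ vertices. For nonnegative edge weights $\mathbf w\in\mathbb R_{\ge 0}^E$, let $\mathrm{dist}_{\mathbf w}(u,v)\in[0,\infty]$ be the smallest total weight of a path from $u$ to $v$ in $G$ ($\infty$ if there is none). The graph is fixed and public; weight vectors $\mathbf w,\mathbf w'$ are neighbors if $\|\mathbf w-\mathbf w'\|_1\le 1$. For $S\subseteq V$, an algorithm for the $S$-pair shortest path distances problem is a randomized map $M$ (a Markov kernel) that takes $\mathbf w$ to estimates $(\tilde d(u,v))_{u,v\in S}$ with values in $[0,\infty]$. It is $\varepsilon$-DP if $\Pr[M(\mathbf w)\in A]\le e^{\varepsilon}\Pr[M(\mathbf w')\in A]$ for all neighbors $\mathbf w,\mathbf w'$ and all measurable sets $A$ of outcomes. The estimates are $(\gamma,\alpha)$-accurate for $\mathbf w$ if $\mathrm{dist}_{\mathbf w}(u,v)-\alpha\le\tilde d(u,v)\le\gamma\,\mathrm{dist}_{\mathbf w}(u,v)+\alpha$ for all $u,v\in S$. **Theorem.** There is an absolute constant $C>0$ such that for every finite undirected graph $G=(V,E)$ with $n=|V|$, every $S\subseteq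 V$, every integer $k\ge 1$ and every $\varepsilon>0$, there is an $\varepsilon$-DP algorithm for the $S$-pair shortest path distances problem on $G$ whose output, for every weight vector $\mathbf w\in\mathbb R_{\ge0}^E$, is $$\left(2k-1,\ \frac{C\,k^2\,|S|^{1+1/k}\,\log^2 n}{\varepsilon}\right)\text{-accurate for }\mathbf w$$ with probability at least $1-1/n$ (for $n\ge 1$). -/

import Mathlib

open MeasureTheory ProbabilityTheory
open scoped ENNReal NNReal

namespace PrivateDistance

/-- An assignment of a nonnegative real weight to every edge of the (fixed) graph `G`. -/
abbrev Weights {V : Type*} (G : SimpleGraph V) : Type _ := G.edgeSet → ℝ≥0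

/-- The total weight of the edges traversed by a walk. -/
def walkWeight {V : Type*} {G : SimpleGraph V} (w : Weights G) :
    {u v : V} → G.Walk u v → ℝ≥0
  | _, _, .nil => 0
  | _, _, .cons h p => w ⟨s(_, _), h⟩ + walkWeight w p

/-- The smallest weight of a path from `u` to `v` in the weighted graph `(G, w)`;
it is `∞` when there is no such path. -/
noncomputable def wdist {V : Type*} {G : SimpleGraph V} (w : Weights G) (u v : V) : ℝ≥0∞ :=
  ⨅ p : G.Path u v, (walkWeight w (p : G.Walk u v) : ℝ≥0∞)

/-- Two weight vectors on the same graph are neighbours if their `ℓ₁`-distance is at most `1`. -/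
def Neighbors {V : Type*} {G : SimpleGraph V} [Fintype G.edgeSet] (w w' : Weights G) : Prop :=
  ∑ e, |(w e : ℝ) - (w' e : ℝ)| ≤ 1

/-- A randomized algorithm for the `S`-pair shortest path distances problem on `G`: to each weight
vector it assigns, measurably, the law of its output, a `[0, ∞]`-valued estimate of the distance
for every pair of vertices in `S`. It is a genuine randomized algorithm when it is Markov. -/
abbrev Mechanism {V : Type*} (G : SimpleGraph V) (S : Finset V) : Type _ :=
  Kernel (Weights G) (S → S → ℝ≥0∞)

/-- `(ε, δ)`-differential privacy with respect to the edge weights. -/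
def IsDP {V : Type*} {G : SimpleGraph V} [Fintype G.edgeSet] {S : Finset V}
    (M : Mechanism G S) (ε δ : ℝ) : Prop :=
  ∀ w w' : Weights G, Neighbors w w' → ∀ A : Set (S → S → ℝ≥0∞), MeasurableSet A →
    M w A ≤ ENNReal.ofReal (Real.exp ε) * M w' A + ENNReal.ofReal δ

/-- The estimate `d` is `(γ, α)`-accurate for the pairs in `S`:
`dist u v - α ≤ d u v ≤ γ * dist u v + α`. Since `d u v ≥ 0`, the truncated
subtraction of `ℝ≥0∞` does not change the meaning of the lower bound; a pair at infinite distance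
must have the estimate `∞`. -/
def IsAccurate {V : Type*} {G : SimpleGraph V} {S : Finset V} (w : Weights G) (γ α : ℝ≥0)
    (d : S → S → ℝ≥0∞) : Prop :=
  ∀ u v : S, wdist w (u : V) (v : V) - α ≤ d u v ∧ d u v ≤ γ * wdist w (u : V) (v : V) + α

end PrivateDistance

/-! The algorithm is an exponential mechanism whose outcomes are sparse weighted graphs on `S`, and
privacy is paid for the size of the sparse graph instead of for all pairs.

Scale distances by `c = ε / 2`, so that passing to a neighbour changes every scaled distance `D` by
at most `c`. An outcome `ω` lists `m`, about `|S|^(1+1/k)`, pairs with integer lengths. Its defect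
is the least `t` for which `IsFit` holds, and its likelihood is essentially `exp (-t)`. The defect
changes by at most `c`, so each likelihood and the normalizer change by a factor of at most `exp c`;
together this gives `exp ε` (`likelihood_le_mul`, `expMechanism_le_mul`).

Some outcome has defect at most 1: the greedy `(2k-1)`-spanner of the metric, with lengths rounded
down. It has girth greater than `2k`, so the Moore bound makes it fit into `m` slots
(`exists_greedy_spanner`, `NoBypass.card_edgeFinset_le`, `exists_isFit_one`). Hence the normalizer
is at least `exp (-1)`.

Outcomes of defect greater than `T` have small total mass, although there are infinitely many. A
defect `t` bounds every slot's deviation from `D`, so half of the exponent pays for `exp (-T/2)` and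
the other half for a product of summable factors, one per slot (`likelihood_le_prod`). The mass is
at most `exp (-T/2) * (6 m |S|^2)^m`, and `T = 22 m log n` suffices. A fit with defect `T` gives
stretch `2k-1` and additive error `(2k-1) T / c` (`IsFit.isAccurate`).

Whether a distance is infinite depends only on the public graph, and a fit never uses a pair at
infinite distance, so disconnected pairs receive `∞`. -/

namespace PrivateDistance

/-! ### Girth, the Moore bound and greedy spanners -/

section Graph

variable {α : Type*}

/-- `u` and `v` are joined by a walk of at most `j` edges. -/
def JoinedWithin (K : SimpleGraph α) (j : ℕ) (u v : α) : Prop :=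
  ∃ p : K.Walk u v, p.length ≤ j

/-- No edge of `K` can be bypassed by a walk of at most `j` edges, that is, the girth of `K` is
greater than `j + 1`. -/
def NoBypass (K : SimpleGraph α) (j : ℕ) : Prop :=
  ∀ u v, K.Adj u v → ¬ JoinedWithin (K.deleteEdges {s(u, v)}) j u v

theorem JoinedWithin.mono {K K' : SimpleGraph α} {i j : ℕ} {u v : α}
    (h : JoinedWithin K i u v) (hK : K ≤ K') (hij : i ≤ j) : JoinedWithin K' j u v := by
  obtain ⟨p, hp⟩ := h
  exact ⟨p.mapLe hK, by simpa using hp.trans hij⟩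

theorem JoinedWithin.symm {K : SimpleGraph α} {i : ℕ} {u v : α}
    (h : JoinedWithin K i u v) : JoinedWithin K i v u := by
  obtain ⟨p, hp⟩ := h
  exact ⟨p.reverse, by simpa using hp⟩

theorem JoinedWithin.trans {K : SimpleGraph α} {i j : ℕ} {u v w : α}
    (h : JoinedWithin K i u v) (h' : JoinedWithin K j v w) : JoinedWithin K (i + j) u w := by
  obtain ⟨p, hp⟩ := h
  obtain ⟨q, hq⟩ := h'
  exact ⟨p.append q, by rw [SimpleGraph.Walk.length_append]; omega⟩

theorem joinedWithin_one {K : SimpleGraph α} {u v : α} (h : K.Adj u v) : JoinedWithin K 1 u v :=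
  ⟨h.toWalk, by simp⟩

theorem NoBypass.anti {K K' : SimpleGraph α} {j : ℕ} (h : NoBypass K j) (hK : K' ≤ K) :
    NoBypass K' j := fun u v huv hs =>
  h u v (hK huv) (hs.mono (SimpleGraph.deleteEdges_mono hK) le_rfl)

/-- A shortest walk to a vertex no farther away than `z` avoids the edges at `z`. -/
theorem joinedWithin_deleteEdges_of_edist_le {K : SimpleGraph α} {x y y' z : α} {j : ℕ}
    (hy : K.edist x y ≤ j) (hyz : K.edist x y ≤ K.edist x z) (hne : y ≠ z) :
    JoinedWithin (K.deleteEdges {s(y', z)}) j x y := by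
  classical
  obtain ⟨p, hp⟩ := SimpleGraph.exists_walk_of_edist_ne_top
    (ne_top_of_le_ne_top (ENat.natCast_ne_top j) hy)
  have hz : z ∉ p.support := by
    intro hz
    have h1 := SimpleGraph.Walk.length_takeUntil_lt_length hz hne.symm
    have h2 := (p.takeUntil z hz).edist_le
    have h3 : (p.length : ℕ∞) ≤ (p.takeUntil z hz).length := hp.le.trans (hyz.trans h2)
    exact absurd (Nat.cast_le.1 h3) (by omega)
  have he : s(y', z) ∉ p.edges := fun h => hz (p.snd_mem_support_of_mem_edges h)
  refine ⟨p.toDeleteEdge _ he, ?_⟩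
  have : (p.length : ℕ∞) ≤ j := hp.le.trans hy
  simpa [SimpleGraph.Walk.toDeleteEdge] using Nat.cast_le.1 this

/-- In a graph of large girth a vertex has at most one neighbour that is no farther from `x`. -/
theorem NoBypass.eq_of_adj {K : SimpleGraph α} {j : ℕ} (h : NoBypass K (2 * j + 1)) {x y y' z : α}
    (hy : K.edist x y ≤ j) (hy' : K.edist x y' ≤ j) (hyz : K.edist x y ≤ K.edist x z)
    (hyz' : K.edist x y' ≤ K.edist x z) (hadj : K.Adj y z) (hadj' : K.Adj y' z) : y = y' := by
  by_contra hne
  refine h y z hadj ?_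
  have h1 := joinedWithin_deleteEdges_of_edist_le (y' := y) hy hyz hadj.ne
  have h2 := joinedWithin_deleteEdges_of_edist_le (y' := y) hy' hyz' hadj'.ne
  have h3 : (K.deleteEdges {s(y, z)}).Adj y' z := by
    rw [SimpleGraph.deleteEdges_adj]
    refine ⟨hadj', fun hh => ?_⟩
    have := Sym2.congr_left.1 (Set.mem_singleton_iff.1 hh)
    exact hne this.symm
  exact ((h1.symm.trans h2).trans (joinedWithin_one h3)).mono le_rfl (by omega)

open Classical in
/-- A form of the Moore bound: in a graph of girth greater than `2 k`, if all non-isolated vertices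
have degree greater than `D`, then there are at least `D ^ k` vertices. -/
theorem NoBypass.pow_le_card [Fintype α] {K : SimpleGraph α} {k D : ℕ}
    (h : NoBypass K (2 * k - 1)) (hdeg : ∀ v, K.degree v = 0 ∨ D + 1 ≤ K.degree v)
    {x : α} (hx : K.degree x ≠ 0) : D ^ k ≤ Fintype.card α := by
  have key : ∀ j ≤ k, D ^ j ≤ (Finset.univ.filter fun y => K.edist x y = j).card := by
    intro j
    induction j with
    | zero =>
      intro _
      have : x ∈ Finset.univ.filter fun y => K.edist x y = (0 : ℕ) := by simp
      simpa using Finset.card_pos.2 ⟨x, this⟩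
    | succ j ih =>
      intro hj
      have hk : NoBypass K (2 * j + 1) := fun u v huv hs =>
        h u v huv (hs.mono le_rfl (by omega))
      have hstep : ∀ {y y'}, K.Adj y y' → K.edist x y' ≤ K.edist x y + 1 := fun {y y'} hadj =>
        SimpleGraph.edist_triangle.trans (by
          gcongr; exact (SimpleGraph.edist_eq_one_iff_adj.2 hadj).le)
      -- Double counting between consecutive spheres around `x`: every vertex at distance `j` has at
      -- least `D` neighbours at distance `j + 1`, and each of those has only one neighbour at
      -- distance `j`.
      have := Finset.card_mul_le_card_mul (m := D) (n := 1) K.Adj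
        (s := Finset.univ.filter fun y => K.edist x y = j)
        (t := Finset.univ.filter fun y => K.edist x y = (j + 1 : ℕ)) ?_ ?_
      · calc D ^ (j + 1) = D ^ j * D := pow_succ _ _
          _ ≤ _ := by gcongr; exact ih (by omega)
          _ ≤ _ := this
          _ = _ := mul_one _
      · intro y hy
        rw [Finset.mem_filter] at hy
        have hdy : D + 1 ≤ K.degree y := by
          refine (hdeg y).resolve_left fun h0 => ?_
          by_cases hxy : x = y
          · exact hx (hxy ▸ h0)
          · have hr := SimpleGraph.reachable_of_edist_ne_top
              (show K.edist x y ≠ ⊤ by rw [hy.2]; exact ENat.natCast_ne_top j)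
            obtain ⟨p⟩ := hr.symm
            cases p with
            | nil => exact hxy rfl
            | cons hadj _ =>
              exact (K.degree_pos_iff_exists_adj y).2 ⟨_, hadj⟩ |>.ne' h0
        rw [← K.card_neighborFinset_eq_degree] at hdy
        set B := (K.neighborFinset y).filter fun z => K.edist x z ≤ j with hB
        have hB1 : B.card ≤ 1 := by
          rw [Finset.card_le_one]
          intro a ha b hb
          simp only [hB, Finset.mem_filter, SimpleGraph.mem_neighborFinset] at ha hb
          exact hk.eq_of_adj (x := x) (z := y) ha.2 hb.2 (hy.2 ▸ ha.2) (hy.2 ▸ hb.2)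
            ha.1.symm hb.1.symm
        have hsub : K.neighborFinset y \ B ⊆ Finset.bipartiteAbove K.Adj
            (Finset.univ.filter fun y => K.edist x y = (j + 1 : ℕ)) y := by
          intro z hz
          simp only [hB, Finset.mem_sdiff, Finset.mem_filter, SimpleGraph.mem_neighborFinset,
            not_and, not_le] at hz
          simp only [Finset.mem_bipartiteAbove, Finset.mem_filter, Finset.mem_univ, true_and]
          refine ⟨le_antisymm ?_ ?_, hz.1⟩
          · simpa [hy.2] using hstep hz.1
          · simpa using Order.add_one_le_of_lt (hz.2 hz.1)
        have h1 := Finset.le_card_sdiff B (K.neighborFinset y)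
        have h2 := Finset.card_le_card hsub
        omega
      · intro z hz
        rw [Finset.mem_filter] at hz
        rw [Finset.card_le_one]
        intro a ha b hb
        simp only [Finset.mem_bipartiteBelow, Finset.mem_filter, Finset.mem_univ, true_and]
          at ha hb
        have hjj : (j : ℕ∞) ≤ (j + 1 : ℕ) := by exact_mod_cast Nat.le_succ j
        exact hk.eq_of_adj (x := x) (z := z) ha.1.le hb.1.le (by rw [ha.1, hz.2]; exact hjj)
          (by rw [hb.1, hz.2]; exact hjj) ha.2 hb.2
  exact (key k le_rfl).trans (Finset.card_le_univ _)

open Classical in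
/-- A graph of girth greater than `2 k` on fewer than `D ^ k` vertices has at most `D` edges per
vertex. -/
theorem NoBypass.card_edgeFinset_le [Fintype α] {k D : ℕ} (hD : Fintype.card α < D ^ k)
    (K : SimpleGraph α) (h : NoBypass K (2 * k - 1)) :
    K.edgeFinset.card ≤ D * Fintype.card α := by
  -- The induction counts non-isolated vertices and removes only edges. The vertex type stays fixed,
  -- so `hD` remains available throughout.
  suffices H : ∀ (N : ℕ) (K : SimpleGraph α), NoBypass K (2 * k - 1) →
      (Finset.univ.filter fun v => K.degree v ≠ 0).card ≤ N → K.edgeFinset.card ≤ D * N from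
    (H _ K h le_rfl).trans (Nat.mul_le_mul_left _ (Finset.card_le_univ _))
  intro N
  induction N with
  | zero =>
    intro K _ hN
    have h0 : ∀ v, K.degree v = 0 := by simpa [Finset.filter_eq_empty_iff] using hN
    have := K.sum_degrees_eq_twice_card_edges
    simp only [h0, Finset.sum_const_zero] at this
    omega
  | succ N ih =>
    intro K hK hN
    by_cases hv : ∃ v, K.degree v ≠ 0 ∧ K.degree v ≤ D
    · obtain ⟨v, hv0, hvD⟩ := hv
      have hle := K.deleteIncidenceSet_le v
      have hcard := K.card_edgeFinset_deleteIncidenceSet v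
      have hi := ih (K.deleteIncidenceSet v) (hK.anti hle) ?_
      · have hi' : K.edgeFinset.card - K.degree v ≤ D * N := by
          rw [← hcard]
          convert hi
        rw [mul_add, mul_one]
        omega
      · have hss : (Finset.univ.filter fun u => (K.deleteIncidenceSet v).degree u ≠ 0) ⊆
            (Finset.univ.filter fun u => K.degree u ≠ 0).erase v := by
          intro u hu
          simp only [Finset.mem_filter, Finset.mem_univ, true_and, Finset.mem_erase] at hu ⊢
          obtain ⟨z, hz⟩ := (SimpleGraph.degree_pos_iff_exists_adj _ u).1 (Nat.pos_of_ne_zero hu)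
          rw [SimpleGraph.deleteIncidenceSet_adj] at hz
          exact ⟨hz.2.1, ((K.degree_pos_iff_exists_adj u).2 ⟨z, hz.1⟩).ne'⟩
        have h1 := Finset.card_le_card hss
        rw [Finset.card_erase_of_mem (by simpa using hv0)] at h1
        have h2 := h1.trans (Nat.sub_le_sub_right hN 1)
        rw [Nat.add_sub_cancel] at h2
        refine le_trans (le_of_eq ?_) h2
        congr!
    · push Not at hv
      have hz : ∀ v, K.degree v = 0 := by
        intro v
        by_contra hv0
        exact absurd (hK.pow_le_card (D := D) (fun u => by
          by_cases hu : K.degree u = 0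
          · exact Or.inl hu
          · exact Or.inr (hv u hu)) hv0) (not_le.2 hD)
      have := K.sum_degrees_eq_twice_card_edges
      simp only [hz, Finset.sum_const_zero] at this
      omega

/-- How a walk uses an additional edge. -/
theorem joinedWithin_of_walk_sup_edge {K K' : SimpleGraph α} {a b : α}
    (hK : ∀ x y, K'.Adj x y → K.Adj x y ∨ (x = a ∧ y = b) ∨ (x = b ∧ y = a))
    {u v : α} (p : K'.Walk u v) :
    JoinedWithin K p.length u v ∨
      (∃ i j, i + j + 1 ≤ p.length ∧ JoinedWithin K i u a ∧ JoinedWithin K j b v) ∨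
      (∃ i j, i + j + 1 ≤ p.length ∧ JoinedWithin K i u b ∧ JoinedWithin K j a v) := by
  have hnil : ∀ x : α, JoinedWithin K 0 x x := fun x => ⟨.nil, le_rfl⟩
  induction p with
  | nil => exact Or.inl (hnil _)
  | cons hadj p ih =>
    rw [SimpleGraph.Walk.length_cons]
    rcases hK _ _ hadj with h | ⟨rfl, rfl⟩ | ⟨rfl, rfl⟩
    · rcases ih with ih | ⟨i, j, hij, h1, h2⟩ | ⟨i, j, hij, h1, h2⟩
      · exact Or.inl (((joinedWithin_one h).trans ih).mono le_rfl (by omega))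
      · exact Or.inr (Or.inl ⟨1 + i, j, by omega, (joinedWithin_one h).trans h1, h2⟩)
      · exact Or.inr (Or.inr ⟨1 + i, j, by omega, (joinedWithin_one h).trans h1, h2⟩)
    · rcases ih with ih | ⟨i, j, hij, h1, h2⟩ | ⟨i, j, hij, h1, h2⟩
      · exact Or.inr (Or.inl ⟨0, p.length, by omega, hnil _, ih⟩)
      · exact Or.inr (Or.inl ⟨0, j, by omega, hnil _, h2⟩)
      · exact Or.inl (h2.mono le_rfl (by omega))
    · rcases ih with ih | ⟨i, j, hij, h1, h2⟩ | ⟨i, j, hij, h1, h2⟩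
      · exact Or.inr (Or.inr ⟨0, p.length, by omega, hnil _, ih⟩)
      · exact Or.inl (h2.mono le_rfl (by omega))
      · exact Or.inr (Or.inr ⟨0, j, by omega, hnil _, h2⟩)

/-- If a short bypass of an old edge `uv` used the new edge `ab`, then exchanging the roles of `uv`
and `ab` on the resulting cycle would join `a` to `b` within `K` by at most `j` edges. -/
theorem NoBypass.sup_edge {K : SimpleGraph α} {j : ℕ} (h : NoBypass K j) {a b : α}
    (hj : ¬ JoinedWithin K j a b) : NoBypass (K ⊔ SimpleGraph.edge a b) j := by
  have hadj : ∀ x y, (K ⊔ SimpleGraph.edge a b).Adj x y →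
      K.Adj x y ∨ (x = a ∧ y = b) ∨ (x = b ∧ y = a) := by
    intro x y hxy
    rw [SimpleGraph.sup_adj, SimpleGraph.edge_adj] at hxy
    tauto
  intro u v huv hs
  by_cases he : s(u, v) = s(a, b)
  · have hle : (K ⊔ SimpleGraph.edge a b).deleteEdges {s(u, v)} ≤ K := by
      intro x y hxy
      rw [SimpleGraph.deleteEdges_adj, he, Set.mem_singleton_iff, Sym2.eq_iff] at hxy
      exact (hadj x y hxy.1).resolve_right hxy.2
    rcases Sym2.eq_iff.1 he with ⟨rfl, rfl⟩ | ⟨rfl, rfl⟩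
    · exact hj (hs.mono hle le_rfl)
    · exact hj (hs.mono hle le_rfl).symm
  · have huv' : K.Adj u v := (hadj u v huv).resolve_right fun hh => he (Sym2.eq_iff.2 hh)
    obtain ⟨p, hp⟩ := hs
    have hle : K.deleteEdges {s(u, v)} ≤ K := SimpleGraph.deleteEdges_le _
    have hK : ∀ x y, ((K ⊔ SimpleGraph.edge a b).deleteEdges {s(u, v)}).Adj x y →
        (K.deleteEdges {s(u, v)}).Adj x y ∨ (x = a ∧ y = b) ∨ (x = b ∧ y = a) := by
      intro x y hxy
      rw [SimpleGraph.deleteEdges_adj] at hxy ⊢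
      rcases hadj x y hxy.1 with hh | hh
      · exact Or.inl ⟨hh, hxy.2⟩
      · exact Or.inr hh
    rcases joinedWithin_of_walk_sup_edge hK p
      with h1 | ⟨i, i', hi, h1, h2⟩ | ⟨i, i', hi, h1, h2⟩
    · exact h u v huv' (h1.mono le_rfl hp)
    · exact hj ((((h1.mono hle le_rfl).symm.trans (joinedWithin_one huv')).trans
        (h2.mono hle le_rfl).symm).mono le_rfl (by omega))
    · exact hj ((((h2.mono hle le_rfl).trans (joinedWithin_one huv'.symm)).trans
        (h1.mono hle le_rfl)).mono le_rfl (by omega))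

open Classical in
/-- The greedy spanner: it has no short cycles, and the endpoints of every edge of `R` are joined in
it by a walk of at most `j` edges, none of which is longer. -/
theorem exists_greedy_spanner [Fintype α] {β : Type*} [LinearOrder β] (R : SimpleGraph α)
    (ℓ : Sym2 α → β) {j : ℕ} (hj : 1 ≤ j) :
    ∃ F ≤ R, NoBypass F j ∧ ∀ u v, R.Adj u v →
      ∃ p : F.Walk u v, p.length ≤ j ∧ ∀ e ∈ p.edges, ℓ e ≤ ℓ s(u, v) := by
  suffices H : ∀ s : Finset (Sym2 α), ((s : Set (Sym2 α)) ⊆ R.edgeSet) →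
      ∃ F ≤ SimpleGraph.fromEdgeSet (s : Set (Sym2 α)), NoBypass F j ∧ ∀ u v, s(u, v) ∈ s →
        ∃ p : F.Walk u v, p.length ≤ j ∧ ∀ e ∈ p.edges, ℓ e ≤ ℓ s(u, v) by
    obtain ⟨F, hF, h1, h2⟩ := H R.edgeFinset (by simp)
    refine ⟨F, hF.trans (by simp), h1, fun u v huv => h2 u v (by simpa using huv)⟩
  intro s
  -- Edges are treated in order of increasing `ℓ`, so whatever already lies in `F` is no longer than
  -- the current edge. An edge is added only if `F` does not yet join its ends within `j` steps.
  refine Finset.induction_on_max_value ℓ s ?_ ?_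
  · intro _
    refine ⟨⊥, bot_le, fun u v huv => ?_, by simp⟩
    simp at huv
  · intro e s hes hmax ih hR
    obtain ⟨F, hF, hF1, hF2⟩ := ih ((Finset.coe_subset.2 (Finset.subset_insert e s)).trans hR)
    have hsub : F ≤ SimpleGraph.fromEdgeSet ((insert e s : Finset (Sym2 α)) : Set (Sym2 α)) :=
      hF.trans (SimpleGraph.fromEdgeSet_mono (Finset.coe_subset.2 (Finset.subset_insert e s)))
    induction e using Sym2.ind with
    | _ a b =>
    have hab : a ≠ b := by
      have : s(a, b) ∈ R.edgeSet := hR (by simp)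
      exact SimpleGraph.Adj.ne this
    by_cases hjn : JoinedWithin F j a b
    · refine ⟨F, hsub, hF1, fun u v huv => ?_⟩
      rcases Finset.mem_insert.1 huv with huv | huv
      · have : JoinedWithin F j u v := by
          rcases Sym2.eq_iff.1 huv with ⟨rfl, rfl⟩ | ⟨rfl, rfl⟩
          · exact hjn
          · exact hjn.symm
        obtain ⟨p, hp⟩ := this
        refine ⟨p, hp, fun e he => ?_⟩
        rw [huv]
        apply hmax
        have := SimpleGraph.edgeSet_mono hF (p.edges_subset_edgeSet he)
        rw [SimpleGraph.edgeSet_fromEdgeSet] at this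
        exact Finset.mem_coe.1 this.1
      · exact hF2 u v huv
    · refine ⟨F ⊔ SimpleGraph.edge a b, sup_le hsub ?_, hF1.sup_edge hjn, fun u v huv => ?_⟩
      · intro x y hxy
        rw [SimpleGraph.edge_adj] at hxy
        rw [SimpleGraph.fromEdgeSet_adj]
        refine ⟨?_, hxy.2⟩
        rw [Finset.mem_coe, Finset.mem_insert]
        exact Or.inl (Sym2.eq_iff.2 (by tauto))
      · rcases Finset.mem_insert.1 huv with huv | huv
        · have hadj : (F ⊔ SimpleGraph.edge a b).Adj u v := by
            rw [SimpleGraph.sup_adj, SimpleGraph.edge_adj]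
            rcases Sym2.eq_iff.1 huv with ⟨rfl, rfl⟩ | ⟨rfl, rfl⟩
            · exact Or.inr ⟨Or.inl ⟨rfl, rfl⟩, hab⟩
            · exact Or.inr ⟨Or.inr ⟨rfl, rfl⟩, hab.symm⟩
          exact ⟨hadj.toWalk, by simpa using hj, by simp⟩
        · obtain ⟨p, hp, hpe⟩ := hF2 u v huv
          exact ⟨p.mapLe le_sup_left, by simpa using hp, by simpa using hpe⟩

end Graph

/-! ### Weighted distances and their sensitivity -/

section WDist

variable {V : Type*} {G : SimpleGraph V}

open Classical in
/-- Weights extended by zero to all pairs of vertices. -/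
noncomputable def extendWeights (w : Weights G) (e : Sym2 V) : ℝ≥0 :=
  if h : e ∈ G.edgeSet then w ⟨e, h⟩ else 0

theorem walkWeight_eq_sum (w : Weights G) {u v : V} (p : G.Walk u v) :
    walkWeight w p = (p.edges.map (extendWeights w)).sum := by
  induction p with
  | nil => simp [walkWeight]
  | cons h p ih =>
    rw [walkWeight, SimpleGraph.Walk.edges_cons, List.map_cons, List.sum_cons, ih, extendWeights,
      dif_pos ((SimpleGraph.mem_edgeSet _).2 h)]

theorem wdist_le_walkWeight (w : Weights G) {u v : V} (p : G.Walk u v) :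
    wdist w u v ≤ walkWeight w p := by
  classical
  refine (iInf_le _ p.toPath).trans ?_
  rw [walkWeight_eq_sum, walkWeight_eq_sum]
  exact_mod_cast (p.edges_bypass_sublist_edges.map _).sum_le_sum fun _ _ => zero_le

theorem wdist_self (w : Weights G) (u : V) : wdist w u u = 0 := by
  simpa [walkWeight] using wdist_le_walkWeight w (SimpleGraph.Walk.nil : G.Walk u u)

theorem wdist_triangle (w : Weights G) (u v x : V) :
    wdist w u x ≤ wdist w u v + wdist w v x := by
  refine ENNReal.le_iInf_add_iInf fun p q => ?_
  refine (wdist_le_walkWeight w ((p : G.Walk u v).append q)).trans (le_of_eq ?_)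
  simp [walkWeight_eq_sum]

theorem wdist_comm (w : Weights G) (u v : V) : wdist w u v = wdist w v u := by
  have key : ∀ u v, wdist w u v ≤ wdist w v u := fun u v => by
    refine le_iInf fun p => ?_
    refine (wdist_le_walkWeight w (p : G.Walk v u).reverse).trans (le_of_eq ?_)
    simp [walkWeight_eq_sum, List.sum_reverse]
  exact le_antisymm (key u v) (key v u)

theorem Neighbors.symm [Fintype G.edgeSet] {w w' : Weights G} (h : Neighbors w w') :
    Neighbors w' w := by
  simpa [Neighbors, abs_sub_comm] using h

/-- A trail uses each edge at most once, so the change is bounded by the `ℓ₁`-distance; a walk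
repeating an edge would count its change several times. -/
theorem Neighbors.walkWeight_le [Fintype G.edgeSet] {w w' : Weights G} (h : Neighbors w w')
    {u v : V} {p : G.Walk u v} (hp : p.IsTrail) : walkWeight w p ≤ walkWeight w' p + 1 := by
  classical
  have hsum : ∀ w : Weights G,
      ((walkWeight w p : ℝ≥0) : ℝ) = ∑ e ∈ p.edges.toFinset, (extendWeights w e : ℝ) := fun w => by
    rw [walkWeight_eq_sum, ← List.sum_toFinset _ hp.edges_nodup]
    push_cast
    rfl
  rw [← NNReal.coe_le_coe, NNReal.coe_add, hsum, hsum, ← sub_le_iff_le_add',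
    ← Finset.sum_sub_distrib]
  calc ∑ e ∈ p.edges.toFinset, ((extendWeights w e : ℝ) - extendWeights w' e)
      ≤ ∑ e ∈ p.edges.toFinset, |(extendWeights w e : ℝ) - extendWeights w' e| :=
        Finset.sum_le_sum fun _ _ => le_abs_self _
    _ ≤ ∑ e ∈ G.edgeSet.toFinset, |(extendWeights w e : ℝ) - extendWeights w' e| := by
        refine Finset.sum_le_sum_of_subset_of_nonneg (fun e he => ?_) fun _ _ _ => abs_nonneg _
        rw [Set.mem_toFinset]
        exact p.edges_subset_edgeSet (List.mem_toFinset.1 he)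
    _ = ∑ e : G.edgeSet, |(extendWeights w e : ℝ) - extendWeights w' e| :=
        (Finset.sum_subtype _ (fun e => Set.mem_toFinset) _)
    _ ≤ 1 := by
        refine le_trans (le_of_eq (Finset.sum_congr rfl fun e _ => ?_)) h
        simp [extendWeights]

theorem Neighbors.wdist_le [Fintype G.edgeSet] {w w' : Weights G} (h : Neighbors w w') (u v : V) :
    wdist w u v ≤ wdist w' u v + 1 := by
  rw [wdist, wdist, ENNReal.iInf_add]
  refine iInf_mono fun p => ?_
  exact_mod_cast h.walkWeight_le p.2.isTrail

theorem measurable_walkWeight {u v : V} (p : G.Walk u v) :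
    Measurable fun w : Weights G => walkWeight w p := by
  induction p with
  | nil => exact measurable_const
  | cons h p ih => exact (measurable_pi_apply _).add ih

theorem measurable_wdist [Finite V] (u v : V) : Measurable fun w : Weights G => wdist w u v := by
  classical
  have := Fintype.ofFinite V
  have : Countable (G.Path u v) := by
    have : Function.Injective fun p : G.Path u v => (p : G.Walk u v).support := fun p q h =>
      Subtype.ext (SimpleGraph.Walk.ext_support h)
    exact this.countable
  exact Measurable.iInf fun p => (measurable_walkWeight _).coe_nnreal_ennreal

end WDist

/-! ### The exponential mechanism with countably many outcomes -/

section ExponentialMechanism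

variable {X Y Ω : Type*} [MeasurableSpace X] [MeasurableSpace Y] [Countable Ω]

/-- The exponential mechanism with countably many outcomes `ω`, whose likelihoods `g x ω` need not
be normalized. -/
noncomputable def expMechanism (g : X → Ω → ℝ≥0∞) (hg : ∀ ω, Measurable fun x => g x ω)
    (out : Ω → Y) : Kernel X Y where
  toFun x := Measure.sum fun ω => (g x ω / ∑' ω', g x ω') • Measure.dirac (out ω)
  measurable' := by
    refine Measure.measurable_of_measurable_coe _ fun A hA => ?_
    simp only [Measure.sum_apply _ hA, Measure.smul_apply, smul_eq_mul]
    exact Measurable.tsum fun ω =>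
      ((hg ω).div (Measurable.tsum fun ω' => hg ω')).mul_const _

theorem expMechanism_apply (g : X → Ω → ℝ≥0∞) (hg : ∀ ω, Measurable fun x => g x ω)
    (out : Ω → Y) (x : X) :
    expMechanism g hg out x =
      Measure.sum fun ω => (g x ω / ∑' ω', g x ω') • Measure.dirac (out ω) := rfl

theorem isMarkovKernel_expMechanism (g : X → Ω → ℝ≥0∞) (hg : ∀ ω, Measurable fun x => g x ω)
    (out : Ω → Y) (h0 : ∀ x, ∑' ω, g x ω ≠ 0) (htop : ∀ x, ∑' ω, g x ω ≠ ⊤) :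
    IsMarkovKernel (expMechanism g hg out) := by
  refine ⟨fun x => ⟨?_⟩⟩
  simp only [expMechanism_apply, Measure.sum_apply _ MeasurableSet.univ, Measure.smul_apply,
    measure_univ, smul_eq_mul, mul_one, div_eq_mul_inv, ENNReal.tsum_mul_right]
  exact ENNReal.mul_inv_cancel (h0 x) (htop x)

/-- One factor `c` comes from the likelihood and the other from the normalizer. -/
theorem expMechanism_le_mul (g : X → Ω → ℝ≥0∞) (hg : ∀ ω, Measurable fun x => g x ω)
    (out : Ω → Y) {c : ℝ≥0∞} (hc0 : c ≠ 0) (hc : c ≠ ⊤) {x y : X}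
    (hxy : ∀ ω, g x ω ≤ c * g y ω) (hyx : ∀ ω, g y ω ≤ c * g x ω) {A : Set Y}
    (hA : MeasurableSet A) :
    expMechanism g hg out x A ≤ c * c * expMechanism g hg out y A := by
  simp only [expMechanism_apply, Measure.sum_apply _ hA, Measure.smul_apply, smul_eq_mul,
    ← ENNReal.tsum_mul_left, div_eq_mul_inv]
  refine ENNReal.tsum_le_tsum fun ω => ?_
  have hZ : (∑' ω', g x ω')⁻¹ ≤ c * (∑' ω', g y ω')⁻¹ := by
    have h : ∑' ω', g y ω' ≤ c * ∑' ω', g x ω' := by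
      rw [← ENNReal.tsum_mul_left]
      exact ENNReal.tsum_le_tsum hyx
    have h' := ENNReal.inv_le_inv.2 h
    rw [ENNReal.mul_inv (Or.inl hc0) (Or.inl hc)] at h'
    calc (∑' ω', g x ω')⁻¹ = c * (c⁻¹ * (∑' ω', g x ω')⁻¹) := by
          rw [← mul_assoc, ENNReal.mul_inv_cancel hc0 hc, one_mul]
      _ ≤ _ := by gcongr
  calc g x ω * (∑' ω', g x ω')⁻¹ * Measure.dirac (out ω) A
      ≤ (c * g y ω) * (c * (∑' ω', g y ω')⁻¹) * Measure.dirac (out ω) A := by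
        gcongr
        exact hxy ω
    _ = _ := by ring

-- The set `A` need not be measurable here, since a sum of measures is bounded below by its terms on
-- every set; measurability of the accuracy event is thus never needed.
open Classical in
theorem one_sub_le_expMechanism (g : X → Ω → ℝ≥0∞) (hg : ∀ ω, Measurable fun x => g x ω)
    (out : Ω → Y) {x : X} (h0 : ∑' ω, g x ω ≠ 0) (htop : ∑' ω, g x ω ≠ ⊤) (P : Ω → Prop)
    {A : Set Y} (hP : ∀ ω, P ω → out ω ∈ A) :
    1 - (∑' ω, if P ω then 0 else g x ω) / ∑' ω, g x ω ≤ expMechanism g hg out x A := by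
  rw [expMechanism_apply]
  refine le_trans ?_ (Measure.le_sum_apply _ _)
  have hsplit : (∑' ω, if P ω then g x ω else 0) + (∑' ω, if P ω then 0 else g x ω) =
      ∑' ω, g x ω := by
    rw [← ENNReal.tsum_add]
    exact tsum_congr fun ω => by split_ifs <;> simp
  have h1 : (∑' ω, if P ω then g x ω else 0) / (∑' ω, g x ω) ≤
      ∑' ω, ((g x ω / ∑' ω', g x ω') • Measure.dirac (out ω)) A := by
    rw [div_eq_mul_inv, ← ENNReal.tsum_mul_right]
    refine ENNReal.tsum_le_tsum fun ω => ?_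
    split_ifs with h
    · rw [Measure.smul_apply, smul_eq_mul, Measure.dirac_apply_of_mem (hP ω h), mul_one,
        div_eq_mul_inv]
    · simp
  refine le_trans ?_ h1
  rw [tsub_le_iff_right, ← ENNReal.add_div, hsplit, ENNReal.div_self h0 htop]

end ExponentialMechanism

/-! ### Sparse graphs as outcomes, and their fit to a metric -/

section Slots

variable {α : Type*} {m : ℕ}

/-- A list of `m` pairs of points, each with a natural number. -/
abbrev Slots (α : Type*) (m : ℕ) : Type _ := Fin m → (α × α) × ℕ

open Classical in
/-- The smallest number attached to the pair `u`, `v`. -/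
noncomputable def slotWeight (ω : Slots α m) (u v : α) : ℝ≥0∞ :=
  if u = v then 0
  else ⨅ i, ⨅ _ : (ω i).1 = (u, v) ∨ (ω i).1 = (v, u), ((ω i).2 : ℝ≥0∞)

open Classical in
/-- The smallest weight, with respect to `A`, of a walk with `j` steps. -/
noncomputable def hopDist (A : α → α → ℝ≥0∞) : ℕ → α → α → ℝ≥0∞
  | 0, u, v => if u = v then 0 else ⊤
  | j + 1, u, v => ⨅ z, A u z + hopDist A j z v

/-- The numbers in `ω` agree with the distances `D` up to `t`, and the `L`-hop distances that they
define have stretch at most `L`, up to an error of `t` per hop. -/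
def IsFit (L : ℕ) (D : α → α → ℝ≥0∞) (ω : Slots α m) (t : ℝ≥0) : Prop :=
  (∀ i, D (ω i).1.1 (ω i).1.2 ≤ (ω i).2 + t ∧ ((ω i).2 : ℝ≥0∞) ≤ D (ω i).1.1 (ω i).1.2 + t) ∧
    ∀ u v, hopDist (slotWeight ω) L u v ≤ L * (D u v + t)

/-- The likelihood `exp (-t)`, where `t` is the quality of the fit of `ω` to `D`. It suffices to
consider values of `t` in a countable set that is invariant under translation by `c`. -/
noncomputable def likelihood (L : ℕ) (c : ℝ≥0) (D : α → α → ℝ≥0∞) (ω : Slots α m) : ℝ≥0∞ :=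
  ⨆ (i : ℕ) (j : ℕ) (_ : IsFit L D ω (c * i + j)), ENNReal.ofReal (Real.exp (-(c * i + j)))

theorem IsFit.mono {L : ℕ} {D : α → α → ℝ≥0∞} {ω : Slots α m} {t t' : ℝ≥0}
    (h : IsFit L D ω t) (ht : t ≤ t') : IsFit L D ω t' := by
  have ht' : (t : ℝ≥0∞) ≤ t' := ENNReal.coe_le_coe.2 ht
  refine ⟨fun i => ⟨(h.1 i).1.trans (by gcongr), (h.1 i).2.trans (by gcongr)⟩, fun u v =>
    (h.2 u v).trans (by gcongr)⟩

theorem IsFit.of_le_add {L : ℕ} {D D' : α → α → ℝ≥0∞} {ω : Slots α m} {t c : ℝ≥0}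
    (h : IsFit L D ω t) (h1 : ∀ u v, D u v ≤ D' u v + c) (h2 : ∀ u v, D' u v ≤ D u v + c) :
    IsFit L D' ω (t + c) := by
  refine ⟨fun i => ⟨(h2 _ _).trans ?_, (h.1 i).2.trans ?_⟩, fun u v => (h.2 u v).trans ?_⟩
  · rw [ENNReal.coe_add, ← add_assoc]
    gcongr
    exact (h.1 i).1
  · rw [ENNReal.coe_add, add_comm (t : ℝ≥0∞), ← add_assoc]
    gcongr
    exact h1 _ _
  · rw [ENNReal.coe_add, add_comm (t : ℝ≥0∞), ← add_assoc]
    gcongr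
    exact h1 _ _

theorem likelihood_le_mul {L : ℕ} {c : ℝ≥0} {D D' : α → α → ℝ≥0∞} (ω : Slots α m)
    (h1 : ∀ u v, D u v ≤ D' u v + c) (h2 : ∀ u v, D' u v ≤ D u v + c) :
    likelihood L c D ω ≤ ENNReal.ofReal (Real.exp c) * likelihood L c D' ω := by
  refine iSup_le fun i => iSup_le fun j => iSup_le fun h => ?_
  -- Raising the defect by `c` is the shift `i ↦ i + 1`, which is why the grid contains multiples of
  -- `c`.
  have h' : IsFit L D' ω (c * (i + 1 : ℕ) + j) := by
    convert h.of_le_add h1 h2 using 1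
    push_cast
    ring
  have hle : ENNReal.ofReal (Real.exp (-(c * (i + 1 : ℕ) + j))) ≤ likelihood L c D' ω :=
    le_iSup_of_le (i + 1) (le_iSup_of_le j (le_iSup_of_le h' le_rfl))
  refine le_trans (le_of_eq ?_) (mul_le_mul_right hle _)
  rw [← ENNReal.ofReal_mul (Real.exp_pos _).le, ← Real.exp_add]
  congr 2
  push_cast
  ring

theorem measurableSet_isFit {X : Type*} [MeasurableSpace X] [Countable α] {L : ℕ}
    {D : X → α → α → ℝ≥0∞} (hD : ∀ u v, Measurable fun x => D x u v) (ω : Slots α m) (t : ℝ≥0) :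
    MeasurableSet {x | IsFit L (D x) ω t} := by
  simp only [IsFit, Set.ofPred_and, Set.ofPred_forall]
  refine MeasurableSet.inter (MeasurableSet.iInter fun i => MeasurableSet.inter ?_ ?_)
    (MeasurableSet.iInter fun u => MeasurableSet.iInter fun v => ?_)
  · exact measurableSet_le (hD _ _) measurable_const
  · exact measurableSet_le measurable_const ((hD _ _).add_const _)
  · exact measurableSet_le measurable_const (((hD u v).add_const _).const_mul _)

theorem measurable_likelihood {X : Type*} [MeasurableSpace X] [Countable α] {L : ℕ} {c : ℝ≥0}
    {D : X → α → α → ℝ≥0∞} (hD : ∀ u v, Measurable fun x => D x u v) (ω : Slots α m) :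
    Measurable fun x => likelihood L c (D x) ω := by
  classical
  refine Measurable.iSup fun i => Measurable.iSup fun j => ?_
  simp only [iSup_eq_if]
  exact Measurable.ite (measurableSet_isFit hD ω _) measurable_const measurable_const

/-- The hop distances of a well-fitting `ω` do not underestimate `D` by much. -/
theorem IsFit.le_hopDist {L : ℕ} {D : α → α → ℝ≥0∞} {ω : Slots α m} {t : ℝ≥0}
    (h : IsFit L D ω t) (hself : ∀ u, D u u = 0) (hcomm : ∀ u v, D u v = D v u)
    (htri : ∀ u v x, D u x ≤ D u v + D v x) (j : ℕ) (u v : α) :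
    D u v ≤ hopDist (slotWeight ω) j u v + j * t := by
  induction j generalizing u with
  | zero =>
    rw [hopDist]
    split_ifs with huv
    · simp [huv, hself]
    · simp
  | succ j ih =>
    rw [hopDist, ENNReal.iInf_add]
    refine le_iInf fun z => ?_
    have hA : D u z ≤ slotWeight ω u z + t := by
      rw [slotWeight]
      split_ifs with huz
      · simp [huz, hself]
      · rw [ENNReal.iInf_add]
        refine le_iInf fun i => ?_
        rw [ENNReal.iInf_add]
        refine le_iInf fun hi => ?_
        have := (h.1 i).1
        rcases hi with hi | hi
        · rwa [hi] at this
        · rw [hi] at this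
          rwa [hcomm]
    calc D u v ≤ D u z + D z v := htri u z v
      _ ≤ (slotWeight ω u z + t) + (hopDist (slotWeight ω) j z v + j * t) := add_le_add hA (ih z)
      _ = _ := by push_cast; ring

/-- `hopDist` takes exactly `j` steps; a shorter walk is padded with loops, which are free by `hA`.
-/
theorem hopDist_le_of_walk {F : SimpleGraph α} {A : α → α → ℝ≥0∞} (hA : ∀ u, A u u = 0)
    {r : ℝ≥0∞} {u v : α} (p : F.Walk u v) (hr : ∀ x y, s(x, y) ∈ p.edges → A x y ≤ r) {j : ℕ}
    (hj : p.length ≤ j) : hopDist A j u v ≤ j * r := by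
  have hself : ∀ j u, hopDist A j u u = 0 := by
    intro j
    induction j with
    | zero => simp [hopDist]
    | succ j ih => exact fun u => le_antisymm ((iInf_le _ u).trans (by simp [hA, ih])) zero_le
  induction p generalizing j with
  | nil => simp [hself]
  | cons hadj p ih =>
    rw [SimpleGraph.Walk.length_cons] at hj
    obtain ⟨j, rfl⟩ : ∃ i, j = i + 1 := ⟨j - 1, by omega⟩
    refine (iInf_le _ _).trans ((add_le_add (hr _ _ (by simp))
      (ih (fun x y hxy => hr x y (by simp [hxy])) (j := j) (by omega))).trans (le_of_eq ?_))
    push_cast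
    ring

open Classical in
/-- Few slots suffice for a good fit. -/
theorem exists_isFit_one [Fintype α] [Nonempty α] {k B : ℕ} (hk : 1 ≤ k)
    (hB : Fintype.card α < B ^ k) (hm : B * Fintype.card α ≤ m) {D : α → α → ℝ≥0∞}
    (hself : ∀ u, D u u = 0) (hcomm : ∀ u v, D u v = D v u) :
    ∃ ω : Slots α m, IsFit (2 * k - 1) D ω 1 := by
  -- The spanner is taken in the graph of all pairs at finite distance, with `D` as edge length.
  let R : SimpleGraph α :=
    { Adj := fun u v => u ≠ v ∧ D u v ≠ ⊤
      symm := ⟨fun u v h => ⟨h.1.symm, hcomm u v ▸ h.2⟩⟩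
      loopless := ⟨fun u h => h.1 rfl⟩ }
  let ℓ : Sym2 α → ℝ≥0∞ := Sym2.lift ⟨D, hcomm⟩
  obtain ⟨F, hFR, hF, hspan⟩ := exists_greedy_spanner R ℓ (j := 2 * k - 1) (by omega)
  have hcard := (hF.card_edgeFinset_le hB).trans hm
  obtain ⟨a⟩ := ‹Nonempty α›
  let slot : Sym2 α → (α × α) × ℕ := fun e => (e.out, ⌊(ℓ e).toReal⌋₊)
  -- Unused slots hold a loop of length 0, which agrees with `D a a = 0`.
  let ω : Slots α m := fun i => (F.edgeFinset.toList.map slot).getD i ((a, a), 0)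
  have hslot : ∀ e, ℓ e ≠ ⊤ → ((slot e).2 : ℝ≥0∞) ≤ ℓ e ∧ ℓ e ≤ (slot e).2 + 1 := by
    intro e he
    rw [← ENNReal.ofReal_toReal he]
    constructor
    · rw [← ENNReal.ofReal_natCast]
      refine ENNReal.ofReal_le_ofReal ?_
      simpa [slot] using Nat.floor_le ENNReal.toReal_nonneg
    · rw [← ENNReal.ofReal_natCast, ← ENNReal.ofReal_one,
        ← ENNReal.ofReal_add (Nat.cast_nonneg _) zero_le_one]
      refine ENNReal.ofReal_le_ofReal ?_
      simpa [slot] using (Nat.lt_floor_add_one _).le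
  have hFtop : ∀ e ∈ F.edgeSet, ℓ e ≠ ⊤ := by
    intro e
    induction e using Sym2.ind with
    | _ x y => exact fun he => (hFR he).2
  have hout : ∀ e, D (slot e).1.1 (slot e).1.2 = ℓ e := fun e => by
    conv_rhs => rw [← Quot.out_eq e]
    rfl
  have hmem : ∀ i, ω i = ((a, a), 0) ∨ ∃ e ∈ F.edgeSet, ω i = slot e := by
    intro i
    by_cases hi : (i : ℕ) < (F.edgeFinset.toList.map slot).length
    · right
      have : ω i ∈ F.edgeFinset.toList.map slot := by
        simp only [ω, List.getD_eq_getElem _ _ hi]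
        exact List.getElem_mem _
      obtain ⟨e, he, h⟩ := List.mem_map.1 this
      exact ⟨e, by simpa using he, h.symm⟩
    · left
      exact List.getD_eq_default _ _ (not_lt.1 hi)
  have hsurj : ∀ e ∈ F.edgeSet, ∃ i, ω i = slot e := by
    intro e he
    have : slot e ∈ F.edgeFinset.toList.map slot :=
      List.mem_map.2 ⟨e, by simpa using he, rfl⟩
    obtain ⟨i, hi, h⟩ := List.getElem_of_mem this
    have him : i < m := lt_of_lt_of_le (by simpa using hi) hcard
    exact ⟨⟨i, him⟩, by simp only [ω, List.getD_eq_getElem _ _ hi, h]⟩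
  have hA0 : ∀ u, slotWeight ω u u = 0 := fun u => by simp [slotWeight]
  refine ⟨ω, fun i => ?_, fun u v => ?_⟩
  · rcases hmem i with h | ⟨e, he, h⟩
    · simp [h, hself]
    · rw [h, hout]
      have := hslot e (hFtop e he)
      exact ⟨by simpa using this.2, this.1.trans le_self_add⟩
  -- Lengths were rounded down, so the stretch bound holds without the additive term.
  · refine le_trans ?_ (mul_le_mul_right (le_self_add (b := ((1 : ℝ≥0) : ℝ≥0∞))) _)
    by_cases huv : u = v
    · subst huv
      exact hopDist_le_of_walk hA0 (SimpleGraph.Walk.nil : F.Walk u u) (by simp) (by simp)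
    by_cases htop : D u v = ⊤
    · rw [htop, ENNReal.mul_top (by norm_cast; omega)]
      exact le_top
    obtain ⟨p, hp, hpe⟩ := hspan u v ⟨huv, htop⟩
    refine hopDist_le_of_walk hA0 p (fun x y hxy => ?_) hp
    refine le_trans ?_ (hpe _ hxy)
    have he := p.edges_subset_edgeSet hxy
    obtain ⟨i, hi⟩ := hsurj _ he
    have hxy' : x ≠ y := SimpleGraph.Adj.ne (SimpleGraph.mem_edgeSet _ |>.1 he)
    rw [slotWeight, if_neg hxy']
    refine (iInf_le _ i).trans ((iInf_le _ ?_).trans ?_)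
    · rw [hi]
      have : s((slot s(x, y)).1.1, (slot s(x, y)).1.2) = s(x, y) := Quot.out_eq s(x, y)
      rcases Sym2.eq_iff.1 this with h | h
      · exact Or.inl (Prod.ext h.1 h.2)
      · exact Or.inr (Prod.ext h.1 h.2)
    · rw [hi]
      exact (hslot _ (hFtop _ he)).1

end Slots

/-! ### Total likelihood of the badly fitting outcomes -/

section Tail

theorem tsum_prod_fin_eq_pow {β : Type*} (f : β → ℝ≥0∞) (m : ℕ) :
    ∑' ω : Fin m → β, ∏ i, f (ω i) = (∑' b, f b) ^ m := by
  induction m with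
  | zero => simp [tsum_fintype]
  | succ m ih =>
    rw [← (Fin.consEquiv fun _ => β).tsum_eq, ENNReal.tsum_prod', pow_succ', ← ih,
      ← ENNReal.tsum_mul_right]
    refine tsum_congr fun b => ?_
    rw [← ENNReal.tsum_mul_left]
    exact tsum_congr fun ω => by simp [Fin.consEquiv, Fin.prod_univ_succ]

theorem tsum_exp_neg_abs_sub_le {a d : ℝ} (ha : 0 < a) (hd : 0 ≤ d) :
    ∑' x : ℕ, ENNReal.ofReal (Real.exp (-(a * |x - d|))) ≤ ENNReal.ofReal (2 * (1 + a⁻¹)) := by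
  set r : ℝ≥0∞ := ENNReal.ofReal (Real.exp (-a)) with hr
  set N := ⌊d⌋₊ with hN
  have hN1 : (N : ℝ) ≤ d := Nat.floor_le hd
  have hN2 : d < N + 1 := Nat.lt_floor_add_one d
  have hpow : ∀ (y : ℝ) (j : ℕ), (j : ℝ) ≤ |y| →
      ENNReal.ofReal (Real.exp (-(a * |y|))) ≤ r ^ j := by
    intro y j hj
    rw [hr, ← ENNReal.ofReal_pow (Real.exp_pos _).le, ← Real.exp_nat_mul]
    refine ENNReal.ofReal_le_ofReal (Real.exp_le_exp.2 ?_)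
    nlinarith
  have hgeom : ∑' j : ℕ, r ^ j ≤ ENNReal.ofReal (1 + a⁻¹) := by
    have h1 : Real.exp (-a) ≤ (1 + a)⁻¹ := by
      rw [Real.exp_neg]
      exact inv_anti₀ (by positivity) (by linarith [Real.add_one_le_exp a])
    have h2 : (0 : ℝ) < 1 - (1 + a)⁻¹ := sub_pos.2 (inv_lt_one_of_one_lt₀ (by linarith))
    rw [ENNReal.tsum_geometric, hr, ← ENNReal.ofReal_one, ← ENNReal.ofReal_sub _
      (Real.exp_pos _).le, ← ENNReal.ofReal_inv_of_pos (by linarith)]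
    refine ENNReal.ofReal_le_ofReal ?_
    calc (1 - Real.exp (-a))⁻¹ ≤ (1 - (1 + a)⁻¹)⁻¹ := inv_anti₀ h2 (by linarith)
      _ = 1 + a⁻¹ := by
        have : 1 + a ≠ 0 := by positivity
        field_simp
        ring_nf
        field_simp
  -- Splitting at `d` leaves two sums, each dominated by a geometric series: `x = N, N - 1, ..., 0`
  -- on the left and `x = N + 1, N + 2, ...` on the right.
  rw [← ENNReal.summable.sum_add_tsum_nat_add' (k := N + 1), two_mul,
    ENNReal.ofReal_add (by positivity) (by positivity)]
  refine add_le_add (le_trans ?_ hgeom) (le_trans ?_ hgeom)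
  · rw [← Finset.sum_range_reflect]
    refine le_trans (Finset.sum_le_sum fun j hj => ?_) (ENNReal.sum_le_tsum (Finset.range (N + 1)))
    rw [Finset.mem_range] at hj
    refine hpow _ j ?_
    rw [abs_sub_comm]
    refine le_trans ?_ (le_abs_self _)
    have : ((N + 1 - 1 - j : ℕ) : ℝ) = N - j := by
      rw [Nat.add_sub_cancel, Nat.cast_sub (by omega)]
    rw [this]
    linarith
  · refine ENNReal.tsum_le_tsum fun j => hpow _ j (le_trans ?_ (le_abs_self _))
    push_cast
    linarith

variable {α : Type*} {m : ℕ}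

open Classical in
/-- The contribution of one slot to the bound on the likelihood. -/
noncomputable def slotFactor (m : ℕ) (D : α → α → ℝ≥0∞) (τ : (α × α) × ℕ) : ℝ≥0∞ :=
  if D τ.1.1 τ.1.2 = ⊤ then 0
  else ENNReal.ofReal (Real.exp (-((2 * m : ℝ)⁻¹ * |τ.2 - (D τ.1.1 τ.1.2).toReal|)))

theorem tsum_slotFactor_le [Fintype α] (hm : 0 < m) (D : α → α → ℝ≥0∞) :
    ∑' τ, slotFactor m D τ ≤ ENNReal.ofReal (6 * m * (Fintype.card α : ℝ) ^ 2) := by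
  have hm' : (1 : ℝ) ≤ m := by exact_mod_cast hm
  have h1 : ∀ p : α × α, ∑' x : ℕ, slotFactor m D (p, x) ≤ ENNReal.ofReal (6 * m) := by
    intro p
    by_cases hp : D p.1 p.2 = ⊤
    · simp [slotFactor, hp]
    · simp only [slotFactor, hp, if_false]
      refine (tsum_exp_neg_abs_sub_le (by positivity) ENNReal.toReal_nonneg).trans
        (ENNReal.ofReal_le_ofReal ?_)
      rw [inv_inv]
      -- With decay rate `a = 1 / (2m)` the bound is `2 (1 + 2m)`, at most `6m` because `m ≥ 1`.
      linarith
  rw [ENNReal.tsum_prod', tsum_fintype]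
  refine (Finset.sum_le_sum fun p _ => h1 p).trans (le_of_eq ?_)
  rw [Finset.sum_const, Finset.card_univ, Fintype.card_prod, nsmul_eq_mul,
    ← ENNReal.ofReal_natCast, ← ENNReal.ofReal_mul (Nat.cast_nonneg _)]
  congr 1
  push_cast
  ring

theorem IsFit.abs_sub_le {L : ℕ} {D : α → α → ℝ≥0∞} {ω : Slots α m} {t : ℝ≥0}
    (h : IsFit L D ω t) (i : Fin m) :
    D (ω i).1.1 (ω i).1.2 ≠ ⊤ ∧ |((ω i).2 : ℝ) - (D (ω i).1.1 (ω i).1.2).toReal| ≤ t := by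
  obtain ⟨h1, h2⟩ := h.1 i
  have htop : D (ω i).1.1 (ω i).1.2 ≠ ⊤ :=
    ne_top_of_le_ne_top (ENNReal.add_ne_top.2 ⟨ENNReal.natCast_ne_top _, ENNReal.coe_ne_top⟩) h1
  refine ⟨htop, abs_le.2 ⟨?_, ?_⟩⟩
  · have := ENNReal.toReal_mono
      (ENNReal.add_ne_top.2 ⟨ENNReal.natCast_ne_top _, ENNReal.coe_ne_top⟩) h1
    rw [ENNReal.toReal_add (ENNReal.natCast_ne_top _) ENNReal.coe_ne_top,
      ENNReal.toReal_natCast, ENNReal.coe_toReal] at this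
    linarith
  · have := ENNReal.toReal_mono (ENNReal.add_ne_top.2 ⟨htop, ENNReal.coe_ne_top⟩) h2
    rw [ENNReal.toReal_add htop ENNReal.coe_ne_top,
      ENNReal.toReal_natCast, ENNReal.coe_toReal] at this
    linarith

/-- Write `exp (-t)` as the square of `exp (-t/2)`. One factor is at most `exp (-T/2)`; the other is
at most the product, since the `m` deviations are each at most `t` and carry the weight `1 / (2m)`.
-/
theorem likelihood_le_prod (hm : 0 < m) {L : ℕ} {c : ℝ≥0} {D : α → α → ℝ≥0∞} {ω : Slots α m}
    {T : ℝ≥0} (hT : ∀ t, IsFit L D ω t → T ≤ t) :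
    likelihood L c D ω ≤
      ENNReal.ofReal (Real.exp (-(T / 2))) * ∏ i, slotFactor m D (ω i) := by
  refine iSup_le fun i => iSup_le fun j => iSup_le fun h => ?_
  have hTt : (T : ℝ) ≤ c * i + j := by exact_mod_cast hT _ h
  have hm' : (0 : ℝ) < m := by exact_mod_cast hm
  have hprod : ∏ i, slotFactor m D (ω i) = ENNReal.ofReal (Real.exp
      (-((2 * m : ℝ)⁻¹ * ∑ i, |((ω i).2 : ℝ) - (D (ω i).1.1 (ω i).1.2).toReal|))) := by
    rw [Finset.mul_sum, ← Finset.sum_neg_distrib, Real.exp_sum,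
      ENNReal.ofReal_prod_of_nonneg fun _ _ => (Real.exp_pos _).le]
    exact Finset.prod_congr rfl fun l _ => by rw [slotFactor, if_neg (h.abs_sub_le l).1]
  rw [hprod, ← ENNReal.ofReal_mul (Real.exp_pos _).le, ← Real.exp_add]
  refine ENNReal.ofReal_le_ofReal (Real.exp_le_exp.2 ?_)
  have hsum : ∑ i, |((ω i).2 : ℝ) - (D (ω i).1.1 (ω i).1.2).toReal| ≤ m * (c * i + j) := by
    refine (Finset.sum_le_sum fun l _ => (h.abs_sub_le l).2).trans (le_of_eq ?_)
    simp [mul_add]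
  have := mul_le_mul_of_nonneg_left hsum (by positivity : (0 : ℝ) ≤ (2 * m : ℝ)⁻¹)
  have h2 : (2 * m : ℝ)⁻¹ * (m * (c * i + j)) = (c * i + j) / 2 := by
    field_simp
  linarith

theorem exp_neg_one_le_tsum_likelihood {L : ℕ} (c : ℝ≥0) {D : α → α → ℝ≥0∞} {ω : Slots α m}
    (h : IsFit L D ω 1) :
    ENNReal.ofReal (Real.exp (-1)) ≤ ∑' ω : Slots α m, likelihood L c D ω := by
  refine le_trans ?_ (ENNReal.le_tsum ω)
  have h' : IsFit L D ω (c * (0 : ℕ) + (1 : ℕ)) := by simpa using h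
  exact le_iSup_of_le 0 (le_iSup_of_le 1 (le_iSup_of_le h' (by simp)))

open Classical in
theorem tsum_likelihood_not_isFit_le [Fintype α] (hm : 0 < m) (L : ℕ) (c : ℝ≥0)
    (D : α → α → ℝ≥0∞) (T : ℝ≥0) :
    ∑' ω : Slots α m, (if IsFit L D ω T then 0 else likelihood L c D ω) ≤
      ENNReal.ofReal (Real.exp (-(T / 2)) * (6 * m * (Fintype.card α : ℝ) ^ 2) ^ m) := by
  have hle : ∀ ω : Slots α m, (if IsFit L D ω T then 0 else likelihood L c D ω) ≤
      ENNReal.ofReal (Real.exp (-(T / 2))) * ∏ i, slotFactor m D (ω i) := by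
    intro ω
    split_ifs with h
    · exact zero_le
    · exact likelihood_le_prod hm fun t ht => le_of_not_ge fun htT => h (ht.mono htT)
  refine (ENNReal.tsum_le_tsum hle).trans ?_
  rw [ENNReal.tsum_mul_left, tsum_prod_fin_eq_pow, ENNReal.ofReal_mul (Real.exp_pos _).le,
    ENNReal.ofReal_pow (by positivity)]
  gcongr
  exact tsum_slotFactor_le hm D

theorem tsum_likelihood_ne_top [Fintype α] (hm : 0 < m) (L : ℕ) (c : ℝ≥0) (D : α → α → ℝ≥0∞) :
    ∑' ω : Slots α m, likelihood L c D ω ≠ ⊤ := by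
  refine ne_top_of_le_ne_top ?_ (ENNReal.tsum_le_tsum fun ω =>
    likelihood_le_prod (T := 0) hm fun t _ => zero_le)
  rw [ENNReal.tsum_mul_left, tsum_prod_fin_eq_pow]
  exact ENNReal.mul_ne_top ENNReal.ofReal_ne_top (ENNReal.pow_ne_top
    (ne_top_of_le_ne_top ENNReal.ofReal_ne_top (tsum_slotFactor_le hm D)))

end Tail

/-! ### From fit to accuracy, and numerical estimates -/

section Accuracy

theorem IsFit.isAccurate {V : Type*} {G : SimpleGraph V} {S : Finset V} {w : Weights G} {m L : ℕ}
    {c T a : ℝ≥0} {ω : Slots S m} (hc : c ≠ 0)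
    (h : IsFit L (fun u v : S => c * wdist w u v) ω T) (ha : L * T / c ≤ a) :
    IsAccurate w L a fun u v => hopDist (slotWeight ω) L u v / c := by
  have hc0 : (c : ℝ≥0∞) ≠ 0 := ENNReal.coe_ne_zero.2 hc
  have hct : (c : ℝ≥0∞) ≠ ⊤ := ENNReal.coe_ne_top
  have ha' : (L * T / c : ℝ≥0∞) ≤ a := by
    have := ENNReal.coe_le_coe.2 ha
    rwa [ENNReal.coe_div hc, ENNReal.coe_mul, ENNReal.coe_natCast] at this
  intro u v
  have hcancel : (c * wdist w (u : V) (v : V) : ℝ≥0∞) / c = wdist w (u : V) (v : V) := by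
    rw [mul_comm, ENNReal.mul_div_cancel_right hc0 hct]
  constructor
  · have h1 := h.le_hopDist (fun u => by simp [wdist_self]) (fun u v => by rw [wdist_comm])
      (fun u v x => by rw [← mul_add]; gcongr; exact wdist_triangle w _ _ _) L u v
    rw [tsub_le_iff_right, ← hcancel]
    refine (ENNReal.div_le_div_right h1 _).trans ?_
    rw [ENNReal.add_div]
    gcongr
  · refine (ENNReal.div_le_div_right (h.2 u v) _).trans ?_
    rw [mul_add, ENNReal.add_div, mul_div_assoc, hcancel, ENNReal.coe_natCast]
    gcongr

theorem tail_bound {n s m : ℕ} (hn : 2 ≤ n) (hs : 1 ≤ s) (hsn : s ≤ n) (hm : 1 ≤ m)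
    (hms : m ≤ 2 * s ^ 2) :
    Real.exp (-(22 * m * Real.log n / 2)) * (6 * m * (s : ℝ) ^ 2) ^ m ≤
      Real.exp (-1) * (n : ℝ)⁻¹ := by
  have hn' : (2 : ℝ) ≤ n := by exact_mod_cast hn
  have hm' : (1 : ℝ) ≤ m := by exact_mod_cast hm
  have hl : 1 / 2 ≤ Real.log n := by
    have := Real.log_le_log two_pos hn'
    linarith [Real.log_two_gt_d9]
  -- This costs `8 m log n` of the available `11 m log n`; the remaining `3 m log n` exceeds `1 +
  -- log n` because `log n ≥ 1/2`.
  have hbase : 6 * m * (s : ℝ) ^ 2 ≤ Real.exp (8 * Real.log n) := by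
    have h1 : (n : ℝ) ^ 8 = Real.exp (8 * Real.log n) := by
      rw [show (8 : ℝ) = (8 : ℕ) by norm_num, Real.exp_nat_mul, Real.exp_log (by linarith)]
    have h2 : 6 * m * s ^ 2 ≤ n ^ 8 := by
      calc 6 * m * s ^ 2 ≤ 6 * (2 * n ^ 2) * n ^ 2 := by
            gcongr
            exact hms.trans (by gcongr)
        _ = 12 * n ^ 4 := by ring
        _ ≤ n ^ 4 * n ^ 4 := by
            gcongr
            calc 12 ≤ 2 ^ 4 := by norm_num
              _ ≤ n ^ 4 := by gcongr
        _ = n ^ 8 := by ring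
    rw [← h1]
    exact_mod_cast h2
  have hpow := pow_le_pow_left₀ (by positivity) hbase m
  rw [← Real.exp_nat_mul] at hpow
  calc _ ≤ Real.exp (-(22 * m * Real.log n / 2)) * Real.exp (m * (8 * Real.log n)) := by gcongr
    _ ≤ Real.exp (-1 + -Real.log n) := by
        rw [← Real.exp_add]
        refine Real.exp_le_exp.2 ?_
        nlinarith [mul_le_mul_of_nonneg_right hm' (by linarith : (0 : ℝ) ≤ Real.log n)]
    _ = _ := by rw [Real.exp_add, Real.exp_neg (Real.log n), Real.exp_log (by linarith)]

theorem error_bound {k n m : ℕ} {r ε : ℝ} (hk : 1 ≤ k) (hn : 2 ≤ n) (hε : 0 < ε)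
    (hmr : (m : ℝ) ≤ 2 * r) :
    ((2 * k - 1 : ℕ) : ℝ) * (22 * m * Real.log n) / (ε / 2) ≤
      352 * (k : ℝ) ^ 2 * r * Real.log n ^ 2 / ε := by
  have hn' : (2 : ℝ) ≤ n := by exact_mod_cast hn
  have hl : 1 / 2 ≤ Real.log n := by
    have := Real.log_le_log two_pos hn'
    linarith [Real.log_two_gt_d9]
  have hkk : ((2 * k - 1 : ℕ) : ℝ) ≤ 2 * (k : ℝ) ^ 2 := by
    have : 2 * k - 1 ≤ 2 * k ^ 2 := by nlinarith [Nat.sub_le (2 * k) 1]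
    exact_mod_cast this
  -- The estimates `hkk` and `hll` give slack away: the left side is only linear in `k` and in `log
  -- n`.
  have hll : Real.log n ≤ 2 * Real.log n ^ 2 := by nlinarith
  rw [div_div_eq_mul_div]
  refine div_le_div_of_nonneg_right ?_ hε.le
  have hr : 0 ≤ r := by linarith [(Nat.cast_nonneg m : (0 : ℝ) ≤ m)]
  calc _ ≤ 2 * (k : ℝ) ^ 2 * (22 * (2 * r) * (2 * Real.log n ^ 2)) * 2 := by gcongr
    _ = _ := by ring

end Accuracy

end PrivateDistance

/-! ### Choice of parameters and conclusion -/

open PrivateDistance in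
theorem mainTheorem7 :
    ∃ C : ℝ, 0 < C ∧
      ∀ (V : Type*) [Fintype V] (G : SimpleGraph V) [Fintype G.edgeSet] (S : Finset V)
        (k : ℕ) (ε : ℝ), 1 ≤ k → 0 < ε →
        ∃ M : PrivateDistance.Mechanism G S, IsMarkovKernel M ∧
          PrivateDistance.IsDP M ε 0 ∧
          ∀ w : PrivateDistance.Weights G,
            1 - ((Fintype.card V : ℝ≥0∞))⁻¹ ≤
              M w {d | PrivateDistance.IsAccurate w ((2 * k - 1 : ℕ) : ℝ≥0)
                (Real.toNNReal (C * (k : ℝ) ^ 2 * (S.card : ℝ) ^ (1 + 1 / (k : ℝ)) *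
                  Real.log (Fintype.card V) ^ 2 / ε)) d} := by
  classical
  -- `352 = 2 * 22 * 2 * 2 * 2`, from `2k - 1 ≤ 2k²`, the constant in `T`, `m ≤ 2r`, `log n ≤ 2 log²
  -- n` and the division by `ε / 2`, as collected in `error_bound`.
  refine ⟨352, by norm_num, fun V _ G _ S k ε hk hε => ?_⟩
  rcases S.eq_empty_or_nonempty with rfl | hS
  · refine ⟨Kernel.const _ (Measure.dirac 0), inferInstance, fun w w' _ A _ => ?_, fun w => ?_⟩
    · simp only [Kernel.const_apply, ENNReal.ofReal_zero, add_zero]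
      exact le_mul_of_one_le_left' (ENNReal.one_le_ofReal.2 (Real.one_le_exp hε.le))
    · rw [Kernel.const_apply, Measure.dirac_apply_of_mem]
      · exact tsub_le_self
      · exact fun u => absurd u.2 (Finset.notMem_empty _)
  have hSne : Nonempty S := hS.to_subtype
  set s := S.card with hs
  have hs1 : 1 ≤ s := Finset.card_pos.2 hS
  have hs1' : (1 : ℝ) ≤ s := by exact_mod_cast hs1
  have hcardS : Fintype.card S = s := Fintype.card_coe S
  have hk' : (1 : ℝ) ≤ k := by exact_mod_cast hk
  set ρ : ℝ := (s : ℝ) ^ (1 / (k : ℝ)) with hρ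
  have hρ1 : 1 ≤ ρ := Real.one_le_rpow hs1' (by positivity)
  have hρs : ρ ≤ s := by
    calc ρ ≤ (s : ℝ) ^ (1 : ℝ) :=
          Real.rpow_le_rpow_of_exponent_le hs1' (by rw [div_le_one (by linarith)]; exact hk')
      _ = s := Real.rpow_one _
  -- The Moore bound needs `|S| < B ^ k` strictly, hence floor plus one; as `ρ ≥ 1`, this at most
  -- doubles `ρ`.
  set B : ℕ := ⌊ρ⌋₊ + 1 with hBdef
  have hBρ : ρ < B := by simpa [hBdef] using Nat.lt_floor_add_one ρ
  have hB2 : (B : ℝ) ≤ 2 * ρ := by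
    have := Nat.floor_le (by linarith : (0 : ℝ) ≤ ρ)
    push_cast [hBdef]
    linarith
  have hB : Fintype.card S < B ^ k := by
    rw [hcardS]
    have h1 : ρ ^ k = s := by
      rw [hρ, ← Real.rpow_natCast, ← Real.rpow_mul (by positivity), one_div,
        inv_mul_cancel₀ (by positivity), Real.rpow_one]
    have h2 : ρ ^ k < (B : ℝ) ^ k := pow_lt_pow_left₀ hBρ (by linarith) (by omega)
    rw [h1] at h2
    exact_mod_cast h2
  set m : ℕ := B * s with hmdef
  have hm : 0 < m := Nat.mul_pos (Nat.succ_pos _) hs1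
  have hms : m ≤ 2 * s ^ 2 := by
    have : (B : ℝ) ≤ 2 * s := hB2.trans (by linarith)
    have hBs : B ≤ 2 * s := by exact_mod_cast this
    rw [hmdef]
    nlinarith
  have hmr : (m : ℝ) ≤ 2 * (s : ℝ) ^ (1 + 1 / (k : ℝ)) := by
    rw [Real.rpow_add (by linarith), Real.rpow_one, hmdef, ← hρ]
    push_cast
    nlinarith
  set c : ℝ≥0 := (ε / 2).toNNReal with hc
  have hcε : (c : ℝ) = ε / 2 := Real.coe_toNNReal _ (by positivity)
  have hc0 : c ≠ 0 := by
    intro h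
    rw [h, NNReal.coe_zero] at hcε
    linarith
  set L : ℕ := 2 * k - 1 with hL
  let D : Weights G → S → S → ℝ≥0∞ := fun w u v => c * wdist w (u : V) (v : V)
  have hD : ∀ u v, Measurable fun w => D w u v := fun u v => (measurable_wdist _ _).const_mul _
  let g : Weights G → Slots S m → ℝ≥0∞ := fun w ω => likelihood L c (D w) ω
  have hg : ∀ ω, Measurable fun w => g w ω := fun ω => measurable_likelihood hD ω
  have hZ1 : ∀ w, ENNReal.ofReal (Real.exp (-1)) ≤ ∑' ω, g w ω := fun w => by
    obtain ⟨ω, hω⟩ := exists_isFit_one (m := m) (D := D w) hk hB (by rw [hcardS])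
      (fun u => by simp [D, wdist_self]) (fun u v => by simp [D, wdist_comm w (u : V)])
    exact exp_neg_one_le_tsum_likelihood c hω
  have hZ0 : ∀ w, ∑' ω, g w ω ≠ 0 := fun w =>
    ((ENNReal.ofReal_pos.2 (Real.exp_pos _)).trans_le (hZ1 w)).ne'
  have hZtop : ∀ w, ∑' ω, g w ω ≠ ⊤ := fun w => tsum_likelihood_ne_top hm L c (D w)
  refine ⟨expMechanism g hg fun ω u v => hopDist (slotWeight ω) L u v / c,
    isMarkovKernel_expMechanism g hg _ hZ0 hZtop, fun w w' hw A hA => ?_, fun w => ?_⟩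
  · have hDle : ∀ {w w' : Weights G}, Neighbors w w' → ∀ u v, D w u v ≤ D w' u v + c := by
      intro w w' h u v
      calc D w u v ≤ c * (wdist w' (u : V) (v : V) + 1) := by
            simp only [D]
            gcongr
            exact h.wdist_le _ _
        _ = _ := by rw [mul_add, mul_one]
    have := expMechanism_le_mul g hg (fun ω u v => hopDist (slotWeight ω) L u v / c)
      (c := ENNReal.ofReal (Real.exp c)) (ENNReal.ofReal_pos.2 (Real.exp_pos _)).ne'
      ENNReal.ofReal_ne_top (fun ω => likelihood_le_mul ω (hDle hw) (hDle hw.symm))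
      (fun ω => likelihood_le_mul ω (hDle hw.symm) (hDle hw)) hA
    rwa [← ENNReal.ofReal_mul (Real.exp_pos _).le, ← Real.exp_add, hcε, add_halves,
      ← add_zero (ENNReal.ofReal (Real.exp ε) * _), ← ENNReal.ofReal_zero] at this
  -- For `n = 1` the required probability is 0; the numerical estimates need `n ≥ 2`.
  · rcases Nat.lt_or_ge (Fintype.card V) 2 with hn | hn
    · have hV : Fintype.card V = 1 := by
        have := Finset.card_le_univ S
        omega
      simp [hV]
    · have hsn : s ≤ Fintype.card V := Finset.card_le_univ S
      have hlog : 0 ≤ Real.log (Fintype.card V) := Real.log_natCast_nonneg _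
      set T : ℝ≥0 := (22 * m * Real.log (Fintype.card V)).toNNReal with hT
      have hTr : (T : ℝ) = 22 * m * Real.log (Fintype.card V) :=
        Real.coe_toNNReal _ (by positivity)
      refine le_trans ?_ (one_sub_le_expMechanism g hg _ (hZ0 w) (hZtop w)
        (fun ω => IsFit L (D w) ω T) fun ω hω => hω.isAccurate hc0 ?_)
      · refine tsub_le_tsub_left ?_ _
        refine ENNReal.div_le_of_le_mul ((tsum_likelihood_not_isFit_le hm L c (D w) T).trans ?_)
        rw [hTr, hcardS]
        refine (ENNReal.ofReal_le_ofReal (tail_bound hn hs1 hsn hm hms)).trans ?_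
        rw [ENNReal.ofReal_mul (Real.exp_pos _).le, mul_comm,
          ENNReal.ofReal_inv_of_pos (by exact_mod_cast (by omega : 0 < Fintype.card V)),
          ENNReal.ofReal_natCast]
        gcongr
        exact hZ1 w
      · refine NNReal.coe_le_coe.1 (le_trans (le_of_eq ?_)
          ((error_bound hk hn hε hmr).trans (Real.le_coe_toNNReal _)))
        push_cast [hTr, hcε]
        rfl
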